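/- Let $p\ge 0$, $b_{\min}\in(0,1)$, $0<\rho_{\min}<\rho_{\max}<1$, and let $\Theta$ be the set of all $(A,b,\rho)\in\mathbb R^{p\times p}\times\mathbb R^p\times\mathbb R^p$ with $a_{ij}\ge 0$, $\sum_j a_{ij}+b_i=1$, $b_i\ge b_{\min}$ and $\rho_i\in[\rho_{\min},\rho_{\max}]$ for all $i,j\in\{1,\dots,p\}$. Let $\theta_0=(A,b,\rho)\in\Theta$ and $c=(b_i\rho_i)_{i}$. Let $(X(k))_{k\ge 0}$ be a Bernoulli autoregressive (BAR) process with parameter $\theta_0$, that is, a $\{0,1\}^p$-valued process with arbitrary initial law such that, for every $k\ge 0$, the noise variables $W_i(k+1)\sim\mathrm{Ber}(\rho_i)$, $i=1,\dots,p$, are independent, $W(k+1)$ is independent of $(X(0),\dots,X(k))$, and, conditionally on $X(0),\dots,X(k)$ and $W(k+1)$, the entries of $X(k+1)$ are independent with $X_i(k+1)\sim\mathrm{Ber}\big(\sum_j a_{ij}X_j(k)+b_iW_i(k+1)\big)$. For $T\ge 1$, $u\in\{0,1\}^p$ and $r\in\{1,\dots,p\}$ let $N_u=\#\{0\le k<T: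 X(k)=u\}$ and $N_{u,r,1}=\#\{0\le k<T: X(k)=u,\ X_r(k+1)=1\}$. Let $u_1,\dots,u_m$ be the distinct states among $X(0),\dots,X(T-1)$, let $U_m\in\mathbb R^{m\times p}$ be the matrix with rows $u_1^\top,\dots,u_m^\top$, and let $y_{m,r}=(N_{u_1,r,1}/N_{u_1},\dots,N_{u_m,r,1}/N_{u_m})^\top$. Define the closed-form estimator by $$\hat c_r=\frac{N_{0_p,r,1}}{N_{0_p}},\qquad \hat a_r=(U_m^\top U_m)^{-1}U_m^\top(y_{m,r}-\hat c_r\mathbf 1_m)\quad(r=1,\dots,p),$$ where $\hat a_r^\top$ is the $r$-th row of $\hat A$, together with $\hat b=\mathbf 1_p-\hat A\mathbf 1_p$, $\hat\rho=\mathrm{diag}(\hat b)^{-1}\hat c$ and $\hat\theta=[(\hat A,\hat b,\hat\rho)]^+$, where $[\cdot]^+$ maps each point to a nearest point of $\Theta$ with respect to some fixed norm (for example the Euclidean one). Then the estimator is strongly consistent: almost surely, for all sufficiently large $T$ it is well defined (the state $0_p$ has been visited, $m\ge p$, $U_m$ has full column rank and $\mathrm{diag}(\hat b)$ is invertible), and,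 as $T\to\infty$, $$\hat c\to c,\qquad \hat A\to A,\qquad (\hat A,\hat b,\hat\rho)\to\theta_0,\qquad \hat\theta\to\theta_0 .$$ Moreover, in the special case where $c_1=\dots=c_p$, the same conclusions hold if $\hat c$ is replaced throughout by $\big(\frac1p\sum_{i=1}^p\hat c_i\big)\mathbf 1_p$. -/

import Mathlib

open MeasureTheory ProbabilityTheory Filter Topology

noncomputable section

namespace BAR

/-- The state space `{0,1}^p`; `true` stands for `1`. -/
abbrev State (p : ℕ) : Type := Fin p → Bool

/-- The real number `0` or `1` represented by a bit. -/
def bit (v : Bool) : ℝ := if v then 1 else 0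

/-- The state `0_p`. -/
def zeroState (p : ℕ) : State p := fun _ => false

/-- The probability that a `Ber(q)` variable takes the value `v`. -/
def bern (q : ℝ) (v : Bool) : ℝ := if v then q else 1 - q

/-- Parameter tuples `θ = (A, b, ρ_w)`. -/
abbrev Params (p : ℕ) : Type := Matrix (Fin p) (Fin p) ℝ × (Fin p → ℝ) × (Fin p → ℝ)

/-- The parameter space `Θ`. -/
def paramSpace (p : ℕ) (bmin ρmin ρmax : ℝ) : Set (Params p) :=
  {θ | (∀ i j, 0 ≤ θ.1 i j) ∧ (∀ i, ∑ j, θ.1 i j + θ.2.1 i = 1) ∧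
    (∀ i, bmin ≤ θ.2.1 i) ∧ ∀ i, ρmin ≤ θ.2.2 i ∧ θ.2.2 i ≤ ρmax}

/-- The vector `c = diag(b) ρ_w`. -/
def cParam {p : ℕ} (θ : Params p) : Fin p → ℝ := fun i => θ.2.1 i * θ.2.2 i

/-- `X` is a BAR process with parameters `θ = (A, b, ρ_w)` and noise `W`:
the entries of `W(k+1)` are independent `Ber(ρ_{w_i})` variables, `W(k+1)` is independent of
`X(0), …, X(k)`, and conditionally on `X(0), …, X(k)` and `W(k+1)` the entries of `X(k+1)` are
independent with `X_i(k+1) ∼ Ber(a_iᵀ X(k) + b_i W_i(k+1))`. The law of `X(0)` is arbitrary. -/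
structure IsBARProcess {p : ℕ} {Ω : Type*} [MeasurableSpace Ω] (μ : Measure Ω) (θ : Params p)
    (X W : ℕ → Ω → State p) : Prop where
  measurable_state : ∀ k, Measurable (X k)
  measurable_noise : ∀ k, Measurable (W k)
  noise_law : ∀ k i, μ.real {ω | W (k + 1) ω i = true} = θ.2.2 i
  noise_indep : ∀ k, iIndepFun (fun (i : Fin p) ω => W (k + 1) ω i) μ
  noise_indep_past : ∀ k, IndepFun (W (k + 1)) (fun ω (t : Fin (k + 1)) => X t ω) μ
  step : ∀ (k : ℕ) (x : ℕ → State p) (w v : State p),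
    μ.real {ω | (∀ t ≤ k, X t ω = x t) ∧ W (k + 1) ω = w ∧ X (k + 1) ω = v} =
      μ.real {ω | (∀ t ≤ k, X t ω = x t) ∧ W (k + 1) ω = w} *
        ∏ i, bern (∑ j, θ.1 i j * bit (x k j) + θ.2.1 i * bit (w i)) (v i)

section Estimator

variable {p : ℕ}

/-- `N_u`: the number of `k ∈ {0,…,T-1}` with `x(k) = u`. -/
def countVisits (x : ℕ → State p) (T : ℕ) (u : State p) : ℕ :=
  ((Finset.range T).filter fun k => x k = u).card

/-- `N_{u,r,1}`: the number of `k ∈ {0,…,T-1}` with `x(k) = u` and `x_r(k+1) = 1`. -/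
def countOnes (x : ℕ → State p) (T : ℕ) (u : State p) (r : Fin p) : ℕ :=
  ((Finset.range T).filter fun k => x k = u ∧ x (k + 1) r = true).card

/-- The empirical conditional frequency `N_{u,r,1} / N_u`. -/
def freq (x : ℕ → State p) (T : ℕ) (u : State p) (r : Fin p) : ℝ :=
  (countOnes x T u r : ℝ) / (countVisits x T u : ℝ)

/-- The estimator `ĉ`. -/
def cHat (x : ℕ → State p) (T : ℕ) : Fin p → ℝ := fun i => freq x T (zeroState p) i

/-- The averaged estimator `(p⁻¹ ∑ᵢ ĉ_i) 1_p`. -/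
def cHatAvg (x : ℕ → State p) (T : ℕ) : Fin p → ℝ := fun _ => (1 / (p : ℝ)) * ∑ i, cHat x T i

/-- The distinct states among `x(0), …, x(T-1)`. -/
def visited (x : ℕ → State p) (T : ℕ) : Finset (State p) := (Finset.range T).image x

/-- The matrix `U_m`. Its rows are indexed by the visited states themselves; the least-squares
estimator does not depend on the order of the rows. -/
def U (x : ℕ → State p) (T : ℕ) : Matrix (visited x T) (Fin p) ℝ :=
  Matrix.of fun u j => bit (u.1 j)

/-- The vector `y_{m,r}`. -/
def y (x : ℕ → State p) (T : ℕ) (r : Fin p) : visited x T → ℝ := fun u => freq x T u.1 r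

/-- The matrix `Â` with rows `â_r = (UᵀU)⁻¹ Uᵀ (y_r - c_r 1)`, where `c` is an estimate of the
noise vector. -/
def AHat (x : ℕ → State p) (T : ℕ) (c : Fin p → ℝ) : Matrix (Fin p) (Fin p) ℝ :=
  Matrix.of fun r =>
    Matrix.mulVec (((U x T).transpose * U x T)⁻¹ * (U x T).transpose)
      (y x T r - c r • (1 : visited x T → ℝ))

/-- `b̂ = 1 - Â 1`. -/
def bHat (x : ℕ → State p) (T : ℕ) (c : Fin p → ℝ) : Fin p → ℝ :=
  1 - Matrix.mulVec (AHat x T c) 1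

/-- `ρ̂_w = diag(b̂)⁻¹ c`. -/
def rhoHat (x : ℕ → State p) (T : ℕ) (c : Fin p → ℝ) : Fin p → ℝ :=
  fun i => c i / bHat x T c i

/-- The unprojected estimate `(Â, b̂, ρ̂_w)`. -/
def rawEstimate (x : ℕ → State p) (T : ℕ) (c : Fin p → ℝ) : Params p :=
  (AHat x T c, bHat x T c, rhoHat x T c)

/-- The formulas for the estimates are meaningful at time `T`: the state `0_p` has been visited,
at least `p` distinct states have been visited, `U_m` has full column rank, and `diag(b̂)` is
invertible. -/
def WellDefined (x : ℕ → State p) (T : ℕ) (c : Fin p → ℝ) : Prop :=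
  zeroState p ∈ visited x T ∧ p ≤ (visited x T).card ∧ (U x T).rank = p ∧
    ∀ i, bHat x T c i ≠ 0

/-- `P` is a nearest-point projection onto the set `S` with respect to `N`. -/
def IsProjection (N : Seminorm ℝ (Params p)) (S : Set (Params p))
    (P : Params p → Params p) : Prop :=
  ∀ z, P z ∈ S ∧ ∀ s ∈ S, N (P z - z) ≤ N (s - z)

end Estimator

end BAR

end

namespace BAR

/-! Averaging out the noise makes `X` a Markov chain whose transition probabilities `trans` depend
on the parameter only through `A` and `c`, and are bounded below by some `δ > 0`. No stationarity or
ergodic theorem is needed: a centred function of two successive states is orthogonal to the past, so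
its time averages vanish almost surely (`strong_law_orthogonal`, `ae_tendsto_average`). Applied to
the indicator of the next state, this gives every state a positive lower frequency; applied to the
next coordinate after a visit to `u`, it makes the empirical frequencies converge to `meanNext`.

The rest is deterministic. Once all states are visited, the least-squares formula is a fixed linear
map of the frequencies minus `c`, and it recovers `A` exactly from the limiting data. Continuity
then gives `b` and `ρ`, as `b` is bounded away from zero. Projecting at most doubles the error. -/

/-! ### Convergence in an arbitrary norm and nearest-point maps -/

theorem tendsto_iff_norm_linearEquiv {ι E F : Type*} [AddCommGroup E] [Module ℝ E]
    [TopologicalSpace E] [IsTopologicalAddGroup E] [ContinuousSMul ℝ E] [T2Space E]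
    [FiniteDimensional ℝ E] [NormedAddCommGroup F] [NormedSpace ℝ F] (e : E ≃ₗ[ℝ] F)
    {l : Filter ι} {z : ι → E} {s : E} :
    Tendsto z l (𝓝 s) ↔ Tendsto (fun n => ‖e (z n - s)‖) l (𝓝 0) := by
  have : FiniteDimensional ℝ F := e.finiteDimensional
  have h := e.toContinuousLinearEquiv.toHomeomorph.isInducing.tendsto_nhds_iff
    (f := z) (l := l) (y := s)
  rw [h, tendsto_iff_norm_sub_tendsto_zero]
  simp

theorem tendsto_iff_seminorm {ι E : Type*} [AddCommGroup E] [Module ℝ E]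
    [TopologicalSpace E] [IsTopologicalAddGroup E] [ContinuousSMul ℝ E] [T2Space E]
    [FiniteDimensional ℝ E] (N : Seminorm ℝ E) (hN : ∀ z, N z = 0 → z = 0)
    {l : Filter ι} {z : ι → E} {s : E} :
    Tendsto z l (𝓝 s) ↔ Tendsto (fun n => N (z n - s)) l (𝓝 0) := by
  let _ : Norm E := ⟨N⟩
  have core : NormedSpace.Core ℝ E :=
    { norm_nonneg := fun x => apply_nonneg N x
      norm_smul := fun c x => map_smul_eq_mul N c x
      norm_triangle := fun x y => map_add_le_add N x y
      norm_eq_zero_iff := fun x => ⟨hN x, fun h => by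
        subst h
        exact map_zero N⟩ }
  -- The second copy of `E` carries the norm `N`; the identity is a homeomorphism because a
  -- finite-dimensional Hausdorff vector topology is unique.
  exact @tendsto_iff_norm_linearEquiv ι E E _ _ _ _ _ _ _
    (NormedAddCommGroup.ofCore core)
    (@NormedSpace.ofCore ℝ E _ (NormedAddCommGroup.ofCore core).toSeminormedAddCommGroup _
      core) (LinearEquiv.refl ℝ E) l z s

theorem tendsto_proj {ι : Type*} {p : ℕ} {S : Set (Params p)} (N : Seminorm ℝ (Params p))
    (hN : ∀ z, N z = 0 → z = 0) {P : Params p → Params p} (hP : IsProjection N S P)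
    {l : Filter ι} {z : ι → Params p} {s : Params p} (hs : s ∈ S) (hz : Tendsto z l (𝓝 s)) :
    Tendsto (fun n => P (z n)) l (𝓝 s) := by
  rw [tendsto_iff_seminorm N hN] at hz ⊢
  -- The factor 2: `N (P z - s) ≤ N (P z - z) + N (z - s) ≤ 2 * N (z - s)`.
  refine squeeze_zero (fun _ => apply_nonneg N _) (fun n => ?_) (by simpa using hz.const_mul 2)
  have h1 := (hP (z n)).2 s hs
  have h2 := map_add_le_add N (P (z n) - z n) (z n - s)
  rw [sub_add_sub_cancel] at h2
  rw [map_sub_rev N s] at h1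
  linarith

/-! ### Strong law from orthogonality -/

/-- A strong law of large numbers for bounded pairwise orthogonal random variables. -/
theorem strong_law_orthogonal {Ω : Type*} [MeasurableSpace Ω] (μ : Measure Ω)
    [IsProbabilityMeasure μ] {ξ : ℕ → Ω → ℝ} (hm : ∀ k, Measurable (ξ k)) {C : ℝ}
    (hC : ∀ k ω, |ξ k ω| ≤ C) (horth : ∀ j k, j < k → ∫ ω, ξ j ω * ξ k ω ∂μ = 0) :
    ∀ᵐ ω ∂μ, Tendsto (fun T : ℕ => (∑ k ∈ Finset.range T, ξ k ω) / T) atTop (𝓝 0) := by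
  have hint : ∀ j k, Integrable (fun ω => ξ j ω * ξ k ω) μ := fun j k =>
    Integrable.of_bound ((hm j).mul (hm k)).aestronglyMeasurable (C * C)
      (ae_of_all _ fun ω => by
        rw [Real.norm_eq_abs, abs_mul]
        exact mul_le_mul (hC j ω) (hC k ω) (abs_nonneg _) ((abs_nonneg _).trans (hC j ω)))
  have horth' : ∀ j k, j ≠ k → ∫ ω, ξ j ω * ξ k ω ∂μ = 0 := by
    intro j k h
    rcases h.lt_or_gt with h | h
    · exact horth j k h
    · simpa only [mul_comm] using horth k j h
  have hsq : ∀ n : ℕ, Integrable (fun ω => (∑ k ∈ Finset.range n, ξ k ω) ^ 2) μ ∧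
      ∫ ω, (∑ k ∈ Finset.range n, ξ k ω) ^ 2 ∂μ ≤ n * C ^ 2 := by
    intro n
    simp only [sq, Finset.sum_mul_sum]
    refine ⟨integrable_finsetSum _ fun j _ => integrable_finsetSum _ fun k _ => hint j k, ?_⟩
    rw [integral_finsetSum _ fun j _ => integrable_finsetSum _ fun k _ => hint j k]
    calc _ ≤ ∑ j ∈ Finset.range n, C * C := by
          refine Finset.sum_le_sum fun j hj => ?_
          rw [integral_finsetSum _ fun k _ => hint j k,
            Finset.sum_eq_single_of_mem j hj fun k _ hk => horth' j k hk.symm]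
          calc _ ≤ ∫ _, C * C ∂μ := by
                refine integral_mono (hint j j) (integrable_const _) fun ω => ?_
                have := hC j ω
                simpa [abs_mul_abs_self] using
                  mul_le_mul this this (abs_nonneg _) ((abs_nonneg _).trans this)
            _ = C * C := by simp
      _ = n * (C * C) := by simp
  -- Along the squares the second moments of the averages are at most `C ^ 2 / n ^ 2`, hence
  -- summable, so the squared averages are almost surely summable.
  have hsub : ∀ᵐ ω ∂μ, Tendsto (fun n : ℕ =>
      ((∑ k ∈ Finset.range (n ^ 2), ξ k ω) / (n ^ 2 : ℕ)) ^ 2) atTop (𝓝 0) := by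
    have hmeas : ∀ n : ℕ, Measurable fun ω =>
        ENNReal.ofReal (((∑ k ∈ Finset.range (n ^ 2), ξ k ω) / (n ^ 2 : ℕ)) ^ 2) := fun n =>
      ENNReal.measurable_ofReal.comp
        (((Finset.measurable_fun_sum _ fun k _ => hm k).div_const _).pow_const 2)
    have hle : ∀ n : ℕ, ∫⁻ ω, ENNReal.ofReal
        (((∑ k ∈ Finset.range (n ^ 2), ξ k ω) / (n ^ 2 : ℕ)) ^ 2) ∂μ ≤
        ENNReal.ofReal (C ^ 2 * (1 / (n : ℝ) ^ 2)) := by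
      intro n
      simp only [div_pow]
      rw [← ofReal_integral_eq_lintegral_ofReal ((hsq _).1.div_const _)
        (ae_of_all _ fun ω => by positivity), integral_div]
      refine ENNReal.ofReal_le_ofReal ?_
      rcases Nat.eq_zero_or_pos n with rfl | hn
      · simp
      have hn' : (0 : ℝ) < n := by exact_mod_cast hn
      rw [div_le_iff₀ (by positivity)]
      refine (hsq _).2.trans (le_of_eq ?_)
      push_cast
      field_simp
    have hfin : ∫⁻ ω, ∑' n : ℕ, ENNReal.ofReal
        (((∑ k ∈ Finset.range (n ^ 2), ξ k ω) / (n ^ 2 : ℕ)) ^ 2) ∂μ ≠ ⊤ := by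
      rw [lintegral_tsum fun n => (hmeas n).aemeasurable]
      refine ne_top_of_le_ne_top ?_ (ENNReal.tsum_le_tsum hle)
      exact ((Real.summable_one_div_nat_pow.2 one_lt_two).mul_left _).tsum_ofReal_ne_top
    filter_upwards [ae_lt_top (Measurable.tsum hmeas) hfin] with ω hω
    have h := ENNReal.tendsto_atTop_zero_of_tsum_ne_top hω.ne
    have h' := (ENNReal.tendsto_toReal ENNReal.zero_ne_top).comp h
    refine h'.congr fun n => ?_
    exact ENNReal.toReal_ofReal (sq_nonneg _)
  filter_upwards [hsub] with ω hω
  have hω' : Tendsto (fun n : ℕ => (∑ k ∈ Finset.range (n ^ 2), ξ k ω) / (n ^ 2 : ℕ))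
      atTop (𝓝 0) := by
    rw [tendsto_zero_iff_abs_tendsto_zero]
    have := (Real.continuous_sqrt.tendsto 0).comp hω
    simpa [Function.comp_def, Real.sqrt_sq_eq_abs] using this
  -- Adding `C` makes the summands nonnegative and the partial sums monotone, so convergence along
  -- the squares fills the gaps, as `(n + 1) ^ 2 / n ^ 2 → 1`.
  have key : Tendsto (fun n : ℕ => (∑ k ∈ Finset.range n, (ξ k ω + C)) / n) atTop (𝓝 C) := by
    refine tendsto_div_of_monotone_of_exists_subseq_tendsto_div _ C ?_ ?_
    · refine monotone_nat_of_le_succ fun n => ?_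
      rw [Finset.sum_range_succ]
      have := (abs_le.1 (hC n ω)).1
      linarith
    · intro a ha
      refine ⟨fun n => n ^ 2, ?_, tendsto_pow_atTop two_ne_zero, ?_⟩
      · have h1 : Tendsto (fun n : ℕ => (1 + 1 / (n : ℝ)) ^ 2) atTop (𝓝 1) := by
          simpa using (tendsto_one_div_atTop_nhds_zero_nat (𝕜 := ℝ)).const_add 1 |>.pow 2
        filter_upwards [h1.eventually_le_const ha, eventually_gt_atTop 0] with n hn hn0
        have hn' : (0 : ℝ) < n := by exact_mod_cast hn0
        calc (((n + 1) ^ 2 : ℕ) : ℝ) = (1 + 1 / (n : ℝ)) ^ 2 * (n : ℝ) ^ 2 := by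
              push_cast
              field_simp
          _ ≤ _ := by
              push_cast
              gcongr
      · have h2 := hω'.add_const C
        rw [zero_add] at h2
        refine h2.congr' ?_
        filter_upwards [eventually_gt_atTop 0] with n hn
        have hn' : (0 : ℝ) < n := by exact_mod_cast hn
        simp only [Finset.sum_add_distrib, Finset.sum_const, Finset.card_range, nsmul_eq_mul]
        push_cast
        field_simp
  have h3 := key.sub_const C
  rw [sub_self] at h3
  refine h3.congr' ?_
  filter_upwards [eventually_gt_atTop 0] with n hn
  have hn' : (0 : ℝ) < n := by exact_mod_cast hn
  simp only [Finset.sum_add_distrib, Finset.sum_const, Finset.card_range, nsmul_eq_mul]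
  field_simp
  ring

/-! ### The Markov chain obtained by averaging out the noise -/

section

variable {p : ℕ}

/-- The probability that a coordinate of the next state is `1`, given the present state. -/
def meanNext (θ : Params p) (u : State p) (i : Fin p) : ℝ :=
  ∑ j, θ.1 i j * bit (u j) + cParam θ i

/-- The one-step transition probabilities of the process. -/
def trans (θ : Params p) (u v : State p) : ℝ := ∏ i, bern (meanNext θ u i) (v i)

theorem sum_bern (q : ℝ) : ∑ v, bern q v = 1 := by
  simp [bern]

theorem sum_prod_bern (q : Fin p → ℝ) : ∑ v : State p, ∏ i, bern (q i) (v i) = 1 := by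
  have := Finset.prod_univ_sum (fun _ : Fin p => (Finset.univ : Finset Bool))
    (fun i v => bern (q i) v)
  rw [Fintype.piFinset_univ] at this
  rw [← this]
  exact Finset.prod_eq_one fun i _ => sum_bern _

theorem sum_trans (θ : Params p) (u : State p) : ∑ v, trans θ u v = 1 := sum_prod_bern _

theorem sum_trans_mul_coord (θ : Params p) (u : State p) (r : Fin p) :
    ∑ v, trans θ u v * bit (v r) = meanNext θ u r := by
  have h := Finset.prod_univ_sum (fun _ : Fin p => (Finset.univ : Finset Bool))
    (fun i v => bern (meanNext θ u i) v * (if i = r then bit v else 1))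
  rw [Fintype.piFinset_univ] at h
  have h1 : ∀ v : State p, trans θ u v * bit (v r) =
      ∏ i, (bern (meanNext θ u i) (v i) * (if i = r then bit (v i) else 1)) := by
    intro v
    rw [Finset.prod_mul_distrib, trans]
    simp
  simp_rw [h1]
  rw [← h, Finset.prod_eq_single r]
  · simp [bern, bit]
  · intro i _ hi
    simpa only [hi, if_false, mul_one] using sum_bern _
  · simp

/-- `bern` is affine in its parameter, so averaging over the noise bit replaces it by its mean. -/
theorem sum_bern_mul_bern (m b q : ℝ) (v : Bool) :
    ∑ w, bern q w * bern (m + b * bit w) v = bern (m + b * q) v := by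
  cases v <;> simp [bern, bit] <;> ring

theorem sum_noise (θ : Params p) (u v : State p) :
    ∑ w : State p, (∏ i, bern (θ.2.2 i) (w i)) *
      ∏ i, bern (∑ j, θ.1 i j * bit (u j) + θ.2.1 i * bit (w i)) (v i) = trans θ u v := by
  simp_rw [← Finset.prod_mul_distrib]
  have h := Finset.prod_univ_sum (fun _ : Fin p => (Finset.univ : Finset Bool))
    (fun i w => bern (θ.2.2 i) w * bern (∑ j, θ.1 i j * bit (u j) + θ.2.1 i * bit w) (v i))
  rw [Fintype.piFinset_univ] at h
  rw [← h]
  exact Finset.prod_congr rfl fun i _ => sum_bern_mul_bern _ _ _ _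

variable {Ω : Type*} [MeasurableSpace Ω] {μ : Measure Ω} {θ : Params p} {X W : ℕ → Ω → State p}

theorem IsBARProcess.noise_real [IsProbabilityMeasure μ] (hX : IsBARProcess μ θ X W) (k : ℕ)
    (w : State p) : μ.real {ω | W (k + 1) ω = w} = ∏ i, bern (θ.2.2 i) (w i) := by
  have hset : {ω | W (k + 1) ω = w} =
      ⋂ i ∈ (Finset.univ : Finset (Fin p)), (fun ω => W (k + 1) ω i) ⁻¹' {w i} := by
    ext ω
    simp [funext_iff]
  have hm : ∀ i, Measurable fun ω => W (k + 1) ω i := fun i =>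
    (measurable_pi_apply i).comp (hX.measurable_noise (k + 1))
  rw [hset, measureReal_def, (hX.noise_indep k).measure_inter_preimage_eq_mul Finset.univ
    (sets := fun i => {w i}) (fun i _ => measurableSet_singleton _), ENNReal.toReal_prod]
  refine Finset.prod_congr rfl fun i _ => ?_
  rw [← measureReal_def]
  have h1 : μ.real ((fun ω => W (k + 1) ω i) ⁻¹' {true}) = θ.2.2 i := hX.noise_law k i
  cases hw : w i
  · have h2 : (fun ω => W (k + 1) ω i) ⁻¹' {false} =
        ((fun ω => W (k + 1) ω i) ⁻¹' {true})ᶜ := by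
      ext ω
      simp
    rw [h2, probReal_compl_eq_one_sub (hm i (measurableSet_singleton _)), h1]
    simp [bern]
  · rw [h1]
    simp [bern]

theorem IsBARProcess.history_noise_real (hX : IsBARProcess μ θ X W)
    (k : ℕ) (x : ℕ → State p) (w : State p) :
    μ.real {ω | (∀ t ≤ k, X t ω = x t) ∧ W (k + 1) ω = w} =
      μ.real {ω | ∀ t ≤ k, X t ω = x t} * μ.real {ω | W (k + 1) ω = w} := by
  have h := (hX.noise_indep_past k).measure_inter_preimage_eq_mul {w}
    {fun t : Fin (k + 1) => x t} (measurableSet_singleton _) (measurableSet_singleton _)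
  have h1 : (fun ω (t : Fin (k + 1)) => X t ω) ⁻¹' {fun t : Fin (k + 1) => x t} =
      {ω | ∀ t ≤ k, X t ω = x t} := by
    ext ω
    simp only [Set.mem_preimage, Set.mem_singleton_iff, funext_iff (β := fun _ => State p),
      Set.mem_ofPred_eq]
    exact ⟨fun h t ht => h ⟨t, Nat.lt_succ_of_le ht⟩, fun h t => h t (Nat.lt_succ_iff.1 t.2)⟩
  rw [h1, Set.inter_comm] at h
  simp only [measureReal_def]
  rw [← ENNReal.toReal_mul, mul_comm]
  exact congrArg ENNReal.toReal h

/-- The set `s` need not be measurable: additivity is used for the restriction of `μ` to `s`, on the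
measurable fibres. -/
theorem measureReal_eq_sum_fiber [IsFiniteMeasure μ] {α : Type*} [Fintype α] [MeasurableSpace α]
    [MeasurableSingletonClass α] {Y : Ω → α} (hY : Measurable Y) (s : Set Ω) :
    μ.real s = ∑ a, μ.real (s ∩ Y ⁻¹' {a}) := by
  classical
  have h2 := measure_biUnion_finset₀ (μ := μ.restrict s) (s := (Finset.univ : Finset α))
    (f := fun a => Y ⁻¹' {a}) ?_ ?_
  · have h3 : (⋃ a ∈ (Finset.univ : Finset α), Y ⁻¹' {a}) = Set.univ := by
      ext ω
      simp
    rw [h3, Measure.restrict_apply_univ] at h2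
    rw [measureReal_def, h2, ENNReal.toReal_sum fun _ _ => measure_ne_top _ _]
    refine Finset.sum_congr rfl fun a _ => ?_
    rw [Measure.restrict_apply (hY (measurableSet_singleton a)), Set.inter_comm, measureReal_def]
  · intro a _ b _ hab
    refine Disjoint.aedisjoint ?_
    rw [Set.disjoint_left]
    rintro ω rfl h
    exact hab h
  · exact fun a _ => (hY (measurableSet_singleton a)).nullMeasurableSet

/-- The Markov property: split by the value of the noise, which is independent of the history, and
sum it out with `sum_noise`. -/
theorem IsBARProcess.history_step_real [IsProbabilityMeasure μ] (hX : IsBARProcess μ θ X W)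
    (k : ℕ) (x : ℕ → State p) (v : State p) :
    μ.real {ω | (∀ t ≤ k, X t ω = x t) ∧ X (k + 1) ω = v} =
      μ.real {ω | ∀ t ≤ k, X t ω = x t} * trans θ (x k) v := by
  rw [measureReal_eq_sum_fiber (hX.measurable_noise (k + 1)), ← sum_noise, Finset.mul_sum]
  refine Finset.sum_congr rfl fun w _ => ?_
  have h := hX.step k x w v
  rw [hX.history_noise_real, hX.noise_real, mul_assoc] at h
  rw [← h]
  congr 1
  ext ω
  simp only [Set.mem_inter_iff, Set.mem_ofPred_eq, Set.mem_preimage, Set.mem_singleton_iff]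
  tauto

theorem integral_comp_eq_sum [IsFiniteMeasure μ] {α : Type*} [Fintype α] [MeasurableSpace α]
    [MeasurableSingletonClass α] {Y : Ω → α} (hY : Measurable Y) (f : α → ℝ) :
    ∫ ω, f (Y ω) ∂μ = ∑ a, μ.real (Y ⁻¹' {a}) * f a := by
  rw [← integral_map hY.aemeasurable (measurable_of_finite f).aestronglyMeasurable,
    integral_fintype .of_finite]
  refine Finset.sum_congr rfl fun a _ => ?_
  rw [map_measureReal_apply hY (measurableSet_singleton a), smul_eq_mul]

/-- A centred function of the next state is orthogonal to every function of the history. -/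
theorem IsBARProcess.integral_history_mul_eq_zero [IsProbabilityMeasure μ]
    (hX : IsBARProcess μ θ X W) (k : ℕ) (F : (Fin (k + 1) → State p) → ℝ)
    (g : State p → State p → ℝ) (hg : ∀ u, ∑ v, trans θ u v * g u v = 0) :
    ∫ ω, F (fun t => X t ω) * g (X k ω) (X (k + 1) ω) ∂μ = 0 := by
  have hH : Measurable fun ω (t : Fin (k + 1)) => X t ω :=
    measurable_pi_lambda _ fun t => hX.measurable_state t
  refine (integral_comp_eq_sum (hH.prodMk (hX.measurable_state (k + 1)))
    (fun a : (Fin (k + 1) → State p) × State p => F a.1 * g (a.1 (Fin.last k)) a.2)).trans ?_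
  rw [Fintype.sum_prod_type]
  refine Finset.sum_eq_zero fun h _ => ?_
  -- Only times up to `k` matter; the default value afterwards is arbitrary.
  let x : ℕ → State p := fun t => if ht : t < k + 1 then h ⟨t, ht⟩ else zeroState p
  have hx : ∀ t (ht : t < k + 1), x t = h ⟨t, ht⟩ := fun t ht => dif_pos ht
  have hxk : x k = h (Fin.last k) := hx k k.lt_succ_self
  have hset : ∀ v, (fun ω => ((fun t : Fin (k + 1) => X t ω), X (k + 1) ω)) ⁻¹' {(h, v)} =
      {ω | (∀ t ≤ k, X t ω = x t) ∧ X (k + 1) ω = v} := by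
    intro v
    ext ω
    simp only [Set.mem_preimage, Set.mem_singleton_iff, Prod.mk.injEq,
      funext_iff (β := fun _ => State p), Set.mem_ofPred_eq]
    refine and_congr_left fun _ => ⟨fun H t ht => ?_, fun H t => ?_⟩
    · rw [hx t (Nat.lt_succ_of_le ht), ← H ⟨t, Nat.lt_succ_of_le ht⟩]
    · rw [H t (Nat.lt_succ_iff.1 t.2), hx t t.2]
  simp_rw [hset, hX.history_step_real, hxk]
  have : ∀ v, μ.real {ω | ∀ t ≤ k, X t ω = x t} * trans θ (h (Fin.last k)) v *
      (F h * g (h (Fin.last k)) v) = (μ.real {ω | ∀ t ≤ k, X t ω = x t} * F h) *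
      (trans θ (h (Fin.last k)) v * g (h (Fin.last k)) v) := fun v => by ring
  simp_rw [this]
  rw [← Finset.mul_sum, hg, mul_zero]

/-- The terms are bounded since the state space is finite. For `j < k` the `j`-th term is a function
of the history up to time `k`, which gives orthogonality. -/
theorem IsBARProcess.ae_tendsto_average [IsProbabilityMeasure μ] (hX : IsBARProcess μ θ X W)
    (g : State p → State p → ℝ) (hg : ∀ u, ∑ v, trans θ u v * g u v = 0) :
    ∀ᵐ ω ∂μ, Tendsto (fun T : ℕ => (∑ k ∈ Finset.range T, g (X k ω) (X (k + 1) ω)) / T)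
      atTop (𝓝 0) := by
  refine strong_law_orthogonal μ (ξ := fun k ω => g (X k ω) (X (k + 1) ω))
    (C := ∑ u, ∑ v, |g u v|) (fun k => ?_) (fun k ω => ?_) fun j k hjk => ?_
  · exact (measurable_of_finite fun a : State p × State p => g a.1 a.2).comp
      ((hX.measurable_state k).prodMk (hX.measurable_state (k + 1)))
  · exact (Finset.single_le_sum (f := fun v => |g (X k ω) v|) (fun _ _ => abs_nonneg _)
      (Finset.mem_univ _)).trans (Finset.single_le_sum (f := fun u => ∑ v, |g u v|)
      (fun _ _ => Finset.sum_nonneg fun _ _ => abs_nonneg _) (Finset.mem_univ _))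
  · exact hX.integral_history_mul_eq_zero k
      (fun h => g (h ⟨j, by omega⟩) (h ⟨j + 1, by omega⟩)) g hg

end

/-! ### Lower bounds on transitions and limits of frequencies -/

section

variable {p : ℕ}

theorem cParam_mem_Icc {bmin ρmin ρmax : ℝ} (hbmin : 0 < bmin) (hρmin : 0 < ρmin)
    {θ : Params p} (hθ : θ ∈ paramSpace p bmin ρmin ρmax) (i : Fin p) :
    bmin * ρmin ≤ cParam θ i ∧ cParam θ i ≤ θ.2.1 i * ρmax := by
  obtain ⟨-, -, hb, hρ⟩ := hθ
  have h1 := hb i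
  obtain ⟨h2, h3⟩ := hρ i
  have h4 : 0 < θ.2.1 i := hbmin.trans_le h1
  exact ⟨mul_le_mul h1 h2 hρmin.le h4.le, mul_le_mul_of_nonneg_left h3 h4.le⟩

theorem meanNext_mem_Icc {bmin ρmin ρmax : ℝ} (hbmin : 0 < bmin) (hρmin : 0 < ρmin)
    (hρmax : ρmax < 1) {θ : Params p} (hθ : θ ∈ paramSpace p bmin ρmin ρmax) (u : State p)
    (i : Fin p) :
    bmin * ρmin ≤ meanNext θ u i ∧ meanNext θ u i ≤ 1 - bmin * (1 - ρmax) := by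
  obtain ⟨h1, h2⟩ := cParam_mem_Icc hbmin hρmin hθ i
  obtain ⟨hA, hs, hb, -⟩ := hθ
  have h3 : 0 ≤ ∑ j, θ.1 i j * bit (u j) := Finset.sum_nonneg fun j _ =>
    mul_nonneg (hA i j) (by unfold bit; split_ifs <;> norm_num)
  have h4 : ∑ j, θ.1 i j * bit (u j) ≤ ∑ j, θ.1 i j := Finset.sum_le_sum fun j _ =>
    mul_le_of_le_one_right (hA i j) (by unfold bit; split_ifs <;> norm_num)
  have h5 := hs i
  have h6 := mul_le_mul_of_nonneg_right (hb i) (sub_nonneg.2 hρmax.le)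
  unfold meanNext
  constructor <;> linarith

/-- The transition probabilities are bounded away from zero. -/
theorem exists_pos_le_trans {bmin ρmin ρmax : ℝ} (hbmin : 0 < bmin) (hρmin : 0 < ρmin)
    (hρmax : ρmax < 1) {θ : Params p} (hθ : θ ∈ paramSpace p bmin ρmin ρmax) :
    ∃ δ > 0, ∀ u v, δ ≤ trans θ u v := by
  have h1 : 0 < bmin * ρmin := mul_pos hbmin hρmin
  have h2 : 0 < bmin * (1 - ρmax) := mul_pos hbmin (sub_pos.2 hρmax)
  refine ⟨∏ _i : Fin p, min (bmin * ρmin) (bmin * (1 - ρmax)),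
    Finset.prod_pos fun _ _ => lt_min h1 h2, fun u v => ?_⟩
  refine Finset.prod_le_prod (fun _ _ => (lt_min h1 h2).le) fun i _ => ?_
  obtain ⟨h3, h4⟩ := meanNext_mem_Icc hbmin hρmin hρmax hθ u i
  unfold bern
  split_ifs
  · exact (min_le_left _ _).trans h3
  · exact (min_le_right _ _).trans (by linarith)

theorem countVisits_eq_sum (x : ℕ → State p) (T : ℕ) (u : State p) :
    (countVisits x T u : ℝ) = ∑ k ∈ Finset.range T, if x k = u then 1 else 0 := by
  simp [countVisits]

theorem countOnes_eq_sum (x : ℕ → State p) (T : ℕ) (u : State p) (r : Fin p) :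
    (countOnes x T u r : ℝ) =
      ∑ k ∈ Finset.range T, (if x k = u then 1 else 0) * bit (x (k + 1) r) := by
  simp [countOnes, bit, ← ite_and, and_comm]

/-- Along a path whose visits obey the law of large numbers, each state has a positive lower
asymptotic frequency. -/
theorem eventually_le_countVisits {θ : Params p} {x : ℕ → State p} {δ : ℝ} (hδ : 0 < δ)
    (hδ' : ∀ u v, δ ≤ trans θ u v) {u : State p}
    (hu : Tendsto (fun T : ℕ => (∑ k ∈ Finset.range T,
      ((if x (k + 1) = u then 1 else 0) - trans θ (x k) u)) / T) atTop (𝓝 0)) :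
    ∀ᶠ T : ℕ in atTop, δ / 2 * T ≤ countVisits x T u := by
  -- Of the lower bound `δ * T`, one `δ / 4 * T` absorbs the boundary term below and another the
  -- law-of-large-numbers error.
  have h1 : ∀ᶠ T : ℕ in atTop, 1 ≤ δ / 4 * (T : ℝ) :=
    (tendsto_natCast_atTop_atTop.const_mul_atTop (by positivity)).eventually_ge_atTop 1
  filter_upwards [h1, hu.eventually_const_le (show -(δ / 4) < 0 by linarith),
    eventually_gt_atTop 0] with T hT1 hT2 hT0
  have hT : (0 : ℝ) < T := by exact_mod_cast hT0
  rw [le_div_iff₀ hT, Finset.sum_sub_distrib] at hT2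
  have h2 : δ * T ≤ ∑ k ∈ Finset.range T, trans θ (x k) u := by
    have := Finset.card_nsmul_le_sum (Finset.range T) (fun k => trans θ (x k) u) δ
      fun k _ => hδ' _ _
    simpa [mul_comm] using this
  -- Arrivals are counted at times `1, …, T`, visits at `0, …, T - 1`; the two counts differ by at
  -- most one.
  have h3 := Finset.sum_range_succ (fun k => if x k = u then (1 : ℝ) else 0) T
  rw [Finset.sum_range_succ', ← countVisits_eq_sum x] at h3
  have h4 : (if x T = u then (1 : ℝ) else 0) ≤ 1 := by split_ifs <;> norm_num
  have h5 : 0 ≤ (if x 0 = u then (1 : ℝ) else 0) := by split_ifs <;> norm_num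
  linarith

/-- The error of the frequency is a centred time average multiplied by `T / N_u`, which is at most
`1 / ε`. -/
theorem tendsto_freq {θ : Params p} {x : ℕ → State p} {ε : ℝ} (hε : 0 < ε)
    {u : State p} {r : Fin p} (hu : ∀ᶠ T : ℕ in atTop, ε * T ≤ countVisits x T u)
    (hr : Tendsto (fun T : ℕ => (∑ k ∈ Finset.range T,
      (if x k = u then 1 else 0) * (bit (x (k + 1) r) - meanNext θ u r)) / T) atTop (𝓝 0)) :
    Tendsto (fun T => freq x T u r) atTop (𝓝 (meanNext θ u r)) := by
  rw [tendsto_iff_norm_sub_tendsto_zero]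
  refine squeeze_zero' (Eventually.of_forall fun _ => norm_nonneg _) ?_
    (by simpa only [norm_zero, mul_zero] using hr.norm.const_mul ε⁻¹)
  filter_upwards [hu, eventually_gt_atTop 0] with T hT hT0
  have hT' : (0 : ℝ) < T := by exact_mod_cast hT0
  have hN : (0 : ℝ) < countVisits x T u := (mul_pos hε hT').trans_le hT
  have h1 : freq x T u r - meanNext θ u r = (∑ k ∈ Finset.range T,
      (if x k = u then 1 else 0) * (bit (x (k + 1) r) - meanNext θ u r)) / countVisits x T u := by
    simp_rw [mul_sub]
    rw [Finset.sum_sub_distrib, ← countOnes_eq_sum, ← Finset.sum_mul, ← countVisits_eq_sum, freq]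
    field_simp
  rw [h1, norm_div, norm_div, Real.norm_of_nonneg hN.le, Real.norm_of_nonneg hT'.le]
  calc _ ≤ _ / (ε * (T : ℝ)) := div_le_div_of_nonneg_left (norm_nonneg _) (by positivity) hT
    _ = _ := by
      field_simp

/-! ### Least squares with the full design -/

/-- The design matrix whose rows are all the states. -/
def fullDesign (p : ℕ) : Matrix (State p) (Fin p) ℝ := Matrix.of fun u j => bit (u j)

/-- The Gram matrix of the full design. -/
def gram (p : ℕ) : Matrix (Fin p) (Fin p) ℝ := (fullDesign p).transpose * fullDesign p

theorem isUnit_gram (p : ℕ) : IsUnit (gram p) := by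
  rw [← Matrix.mulVec_injective_iff_isUnit, ← Matrix.coe_mulVecLin, injective_iff_map_eq_zero]
  intro v hv
  have h := (Matrix.conjTranspose_mul_self_mulVec_eq_zero (fullDesign p) v).1 (by
    rw [Matrix.conjTranspose_eq_transpose_of_trivial]
    exact hv)
  funext i
  -- Evaluating at the state that is `1` only at `i` reads off the `i`-th coordinate of a kernel
  -- vector.
  have := congrFun h fun j => decide (j = i)
  simpa [Matrix.mulVec, dotProduct, fullDesign, bit] using this

theorem transpose_U_mul_U {x : ℕ → State p} {T : ℕ} (h : visited x T = Finset.univ) :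
    (U x T).transpose * U x T = gram p := by
  ext i j
  simp only [gram, Matrix.mul_apply, Matrix.transpose_apply, U, fullDesign, Matrix.of_apply]
  rw [Finset.sum_coe_sort (visited x T) (fun u => bit (u i) * bit (u j)), h]

theorem rank_U {x : ℕ → State p} {T : ℕ} (h : visited x T = Finset.univ) :
    (U x T).rank = p := by
  rw [← Matrix.rank_transpose_mul_self, transpose_U_mul_U h, Matrix.rank_of_isUnit _ (isUnit_gram p),
    Fintype.card_fin]

/-- Removes the index type `visited x T`, which varies with `T`, so that continuity of one fixed
linear map applies. -/
theorem AHat_eq {x : ℕ → State p} {T : ℕ} (h : visited x T = Finset.univ) (c : Fin p → ℝ) :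
    AHat x T c = Matrix.of fun r => Matrix.mulVec (gram p)⁻¹
      (Matrix.mulVec (fullDesign p).transpose fun u => freq x T u r - c r) := by
  ext r i
  have h1 : Matrix.mulVec (U x T).transpose (y x T r - c r • (1 : visited x T → ℝ)) =
      Matrix.mulVec (fullDesign p).transpose fun u => freq x T u r - c r := by
    funext j
    simp only [Matrix.mulVec, dotProduct, Matrix.transpose_apply, U, fullDesign, Matrix.of_apply,
      y, Pi.sub_apply, Pi.smul_apply, Pi.one_apply, smul_eq_mul, mul_one]
    rw [Finset.sum_coe_sort (visited x T) (fun u => bit (u j) * (freq x T u r - c r)), h]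
  simp only [AHat, Matrix.of_apply]
  rw [transpose_U_mul_U h, ← Matrix.mulVec_mulVec, h1]

theorem tendsto_AHat {θ : Params p} {x : ℕ → State p} {c : ℕ → Fin p → ℝ}
    (hvis : ∀ᶠ T in atTop, visited x T = Finset.univ)
    (hfreq : ∀ u r, Tendsto (fun T => freq x T u r) atTop (𝓝 (meanNext θ u r)))
    (hc : Tendsto c atTop (𝓝 (cParam θ))) :
    Tendsto (fun T => AHat x T (c T)) atTop (𝓝 θ.1) := by
  -- Least squares is exact on the limiting data, since `meanNext θ u r - cParam θ r` is linear in
  -- `u` with coefficients `θ.1 r`.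
  have h1 : θ.1 = Matrix.of fun r => Matrix.mulVec (gram p)⁻¹
      (Matrix.mulVec (fullDesign p).transpose fun u => meanNext θ u r - cParam θ r) := by
    ext r i
    have h2 : (fun u => meanNext θ u r - cParam θ r) = Matrix.mulVec (fullDesign p) (θ.1 r) := by
      funext u
      simp [meanNext, Matrix.mulVec, dotProduct, fullDesign, mul_comm]
    rw [Matrix.of_apply, h2, Matrix.mulVec_mulVec, Matrix.mulVec_mulVec, Matrix.mul_assoc,
      show (fullDesign p).transpose * fullDesign p = gram p from rfl,
      Matrix.nonsing_inv_mul _ ((Matrix.isUnit_iff_isUnit_det _).1 (isUnit_gram p)),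
      Matrix.one_mulVec]
  have h3 : Tendsto (fun T => Matrix.of fun r => Matrix.mulVec (gram p)⁻¹
      (Matrix.mulVec (fullDesign p).transpose fun u => freq x T u r - c T r)) atTop (𝓝 θ.1) := by
    rw [h1]
    refine tendsto_pi_nhds.2 fun r => ?_
    have h4 : Tendsto (fun T u => freq x T u r - c T r) atTop
        (𝓝 fun u => meanNext θ u r - cParam θ r) :=
      tendsto_pi_nhds.2 fun u => (hfreq u r).sub (tendsto_pi_nhds.1 hc r)
    have h5 : Continuous fun z : State p → ℝ =>
        Matrix.mulVec (gram p)⁻¹ (Matrix.mulVec (fullDesign p).transpose z) := by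
      fun_prop
    exact (h5.tendsto _).comp h4
  refine h3.congr' ?_
  filter_upwards [hvis] with T hT
  rw [AHat_eq hT]

/-! ### Consistency of the estimators -/

/-- Consistency along a single path, for any consistent estimate `c` of the noise vector. -/
theorem consistent_of_tendsto {bmin ρmin ρmax : ℝ} (hbmin : 0 < bmin) {θ : Params p}
    (hθ : θ ∈ paramSpace p bmin ρmin ρmax) (N : Seminorm ℝ (Params p))
    (hN : ∀ z, N z = 0 → z = 0) {proj : Params p → Params p}
    (hproj : IsProjection N (paramSpace p bmin ρmin ρmax) proj) {x : ℕ → State p}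
    {c : ℕ → Fin p → ℝ} (hvis : ∀ᶠ T in atTop, visited x T = Finset.univ)
    (hfreq : ∀ u r, Tendsto (fun T => freq x T u r) atTop (𝓝 (meanNext θ u r)))
    (hc : Tendsto c atTop (𝓝 (cParam θ))) :
    (∀ᶠ T in atTop, WellDefined x T (c T)) ∧ Tendsto c atTop (𝓝 (cParam θ)) ∧
      Tendsto (fun T => AHat x T (c T)) atTop (𝓝 θ.1) ∧
      Tendsto (fun T => rawEstimate x T (c T)) atTop (𝓝 θ) ∧
      Tendsto (fun T => proj (rawEstimate x T (c T))) atTop (𝓝 θ) := by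
  have hA := tendsto_AHat hvis hfreq hc
  have hb0 : ∀ i, θ.2.1 i ≠ 0 := fun i => (hbmin.trans_le (hθ.2.2.1 i)).ne'
  have hb : Tendsto (fun T => bHat x T (c T)) atTop (𝓝 θ.2.1) := by
    have h1 : θ.2.1 = 1 - Matrix.mulVec θ.1 1 := by
      funext i
      have := hθ.2.1 i
      simp only [Pi.sub_apply, Pi.one_apply, Matrix.mulVec, dotProduct, mul_one]
      linarith
    rw [h1]
    have h2 : Continuous fun M : Matrix (Fin p) (Fin p) ℝ => 1 - Matrix.mulVec M 1 := by
      fun_prop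
    exact (h2.tendsto _).comp hA
  have hρ : Tendsto (fun T => rhoHat x T (c T)) atTop (𝓝 θ.2.2) := by
    refine tendsto_pi_nhds.2 fun i => ?_
    have h1 := (tendsto_pi_nhds.1 hc i).div (tendsto_pi_nhds.1 hb i) (hb0 i)
    rwa [cParam, mul_div_cancel_left₀ _ (hb0 i)] at h1
  have hraw : Tendsto (fun T => rawEstimate x T (c T)) atTop (𝓝 θ) :=
    hA.prodMk_nhds (hb.prodMk_nhds hρ)
  refine ⟨?_, hc, hA, hraw, tendsto_proj N hN hproj hθ hraw⟩
  have hb' : ∀ᶠ T in atTop, ∀ i, bHat x T (c T) i ≠ 0 :=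
    eventually_all.2 fun i => (tendsto_pi_nhds.1 hb i).eventually_ne (hb0 i)
  filter_upwards [hvis, hb'] with T hT hTb
  refine ⟨by simp [hT], ?_, rank_U hT, hTb⟩
  rw [hT, Finset.card_univ, Fintype.card_pi]
  -- All `2 ^ p` states are visited, and `p ≤ 2 ^ p`.
  simpa using Nat.lt_two_pow_self.le

variable {Ω : Type*} [MeasurableSpace Ω] {μ : Measure Ω} {θ : Params p} {X W : ℕ → Ω → State p}

/-- All the probability is used here: finitely many almost sure limits are intersected, after which
the argument runs path by path. -/
theorem IsBARProcess.ae_visited_and_tendsto_freq [IsProbabilityMeasure μ]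
    (hX : IsBARProcess μ θ X W) {δ : ℝ} (hδ : 0 < δ) (hδ' : ∀ u v, δ ≤ trans θ u v) :
    ∀ᵐ ω ∂μ, (∀ᶠ T in atTop, visited (fun k => X k ω) T = Finset.univ) ∧
      ∀ u r, Tendsto (fun T => freq (fun k => X k ω) T u r) atTop (𝓝 (meanNext θ u r)) := by
  have h1 : ∀ u : State p, ∀ᵐ ω ∂μ, Tendsto (fun T : ℕ => (∑ k ∈ Finset.range T,
      ((if X (k + 1) ω = u then 1 else 0) - trans θ (X k ω) u)) / T) atTop (𝓝 0) := by
    intro u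
    refine hX.ae_tendsto_average (fun w v => (if v = u then 1 else 0) - trans θ w u) fun w => ?_
    simp [mul_sub, Finset.sum_sub_distrib, ← Finset.sum_mul, sum_trans]
  have h2 : ∀ (u : State p) (r : Fin p), ∀ᵐ ω ∂μ, Tendsto (fun T : ℕ => (∑ k ∈ Finset.range T,
      (if X k ω = u then 1 else 0) * (bit (X (k + 1) ω r) - meanNext θ u r)) / T)
      atTop (𝓝 0) := by
    intro u r
    refine hX.ae_tendsto_average
      (fun w v => (if w = u then 1 else 0) * (bit (v r) - meanNext θ u r)) fun w => ?_
    split_ifs with h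
    · subst h
      simp [mul_sub, Finset.sum_sub_distrib, ← Finset.sum_mul, sum_trans, sum_trans_mul_coord]
    · simp
  filter_upwards [ae_all_iff.2 h1, ae_all_iff.2 fun u => ae_all_iff.2 (h2 u)] with ω hω1 hω2
  have h3 : ∀ u, ∀ᶠ T : ℕ in atTop, δ / 2 * T ≤ countVisits (fun k => X k ω) T u := fun u =>
    eventually_le_countVisits hδ hδ' (hω1 u)
  refine ⟨?_, fun u r => tendsto_freq (half_pos hδ) (h3 u) (hω2 u r)⟩
  filter_upwards [eventually_all.2 h3, eventually_gt_atTop 0] with T hT hT0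
  refine Finset.eq_univ_iff_forall.2 fun u => ?_
  have hT' : (0 : ℝ) < T := by exact_mod_cast hT0
  have h4 : (0 : ℝ) < countVisits (fun k => X k ω) T u :=
    (mul_pos (half_pos hδ) hT').trans_le (hT u)
  obtain ⟨k, hk⟩ := Finset.card_pos.1 (Nat.cast_pos.1 h4)
  exact Finset.mem_image.2 ⟨k, Finset.mem_filter.1 hk⟩

theorem tendsto_cHat {x : ℕ → State p}
    (hfreq : ∀ u r, Tendsto (fun T => freq x T u r) atTop (𝓝 (meanNext θ u r))) :
    Tendsto (cHat x) atTop (𝓝 (cParam θ)) := by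
  refine tendsto_pi_nhds.2 fun i => ?_
  simpa [cHat, meanNext, zeroState, bit] using hfreq (zeroState p) i

theorem tendsto_cHatAvg {x : ℕ → State p} (hc : Tendsto (cHat x) atTop (𝓝 (cParam θ)))
    (heq : ∀ i j, cParam θ i = cParam θ j) : Tendsto (cHatAvg x) atTop (𝓝 (cParam θ)) := by
  refine tendsto_pi_nhds.2 fun i => ?_
  -- The index `i` itself forces `p` to be positive; for `p = 0` there is no coordinate to check.
  have hp : (p : ℝ) ≠ 0 := Nat.cast_ne_zero.2 i.pos.ne'
  have h := (tendsto_finsetSum Finset.univ fun j _ => tendsto_pi_nhds.1 hc j).const_mul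
    (1 / (p : ℝ))
  have h1 : 1 / (p : ℝ) * ∑ j, cParam θ j = cParam θ i := by
    rw [Finset.sum_congr rfl fun j _ => heq j i]
    simp
    field_simp
  rwa [h1] at h

end

end BAR

theorem theorem3 {p : ℕ} {bmin ρmin ρmax : ℝ}
    (hbmin : 0 < bmin) (hbmin' : bmin < 1)
    (hρmin : 0 < ρmin) (hρ : ρmin < ρmax) (hρmax : ρmax < 1)
    (θ₀ : BAR.Params p) (hθ₀ : θ₀ ∈ BAR.paramSpace p bmin ρmin ρmax)
    {Ω : Type*} [MeasurableSpace Ω] (μ : Measure Ω) [IsProbabilityMeasure μ]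
    (X W : ℕ → Ω → BAR.State p) (hX : BAR.IsBARProcess μ θ₀ X W)
    (N : Seminorm ℝ (BAR.Params p)) (hN : ∀ z, N z = 0 → z = 0)
    (proj : BAR.Params p → BAR.Params p)
    (hproj : BAR.IsProjection N (BAR.paramSpace p bmin ρmin ρmax) proj) :
    (∀ᵐ ω ∂μ,
      (∀ᶠ T in atTop, BAR.WellDefined (fun k => X k ω) T (BAR.cHat (fun k => X k ω) T)) ∧
      Tendsto (fun T => BAR.cHat (fun k => X k ω) T) atTop (𝓝 (BAR.cParam θ₀)) ∧
      Tendsto (fun T => BAR.AHat (fun k => X k ω) T (BAR.cHat (fun k => X k ω) T))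
        atTop (𝓝 θ₀.1) ∧
      Tendsto (fun T => BAR.rawEstimate (fun k => X k ω) T (BAR.cHat (fun k => X k ω) T))
        atTop (𝓝 θ₀) ∧
      Tendsto (fun T => proj
          (BAR.rawEstimate (fun k => X k ω) T (BAR.cHat (fun k => X k ω) T)))
        atTop (𝓝 θ₀)) ∧
    ((∀ i j, BAR.cParam θ₀ i = BAR.cParam θ₀ j) →
      ∀ᵐ ω ∂μ,
        (∀ᶠ T in atTop,
          BAR.WellDefined (fun k => X k ω) T (BAR.cHatAvg (fun k => X k ω) T)) ∧
        Tendsto (fun T => BAR.cHatAvg (fun k => X k ω) T) atTop (𝓝 (BAR.cParam θ₀)) ∧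
        Tendsto (fun T => BAR.AHat (fun k => X k ω) T (BAR.cHatAvg (fun k => X k ω) T))
          atTop (𝓝 θ₀.1) ∧
        Tendsto (fun T => BAR.rawEstimate (fun k => X k ω) T (BAR.cHatAvg (fun k => X k ω) T))
          atTop (𝓝 θ₀) ∧
        Tendsto (fun T => proj
            (BAR.rawEstimate (fun k => X k ω) T (BAR.cHatAvg (fun k => X k ω) T)))
          atTop (𝓝 θ₀)) := by
  obtain ⟨δ, hδ, hδ'⟩ := BAR.exists_pos_le_trans hbmin hρmin hρmax hθ₀
  have h := hX.ae_visited_and_tendsto_freq hδ hδ'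
  refine ⟨?_, fun heq => ?_⟩
  · filter_upwards [h] with ω hω
    exact BAR.consistent_of_tendsto hbmin hθ₀ N hN hproj hω.1 hω.2 (BAR.tendsto_cHat hω.2)
  · filter_upwards [h] with ω hω
    exact BAR.consistent_of_tendsto hbmin hθ₀ N hN hproj hω.1 hω.2
      (BAR.tendsto_cHatAvg (BAR.tendsto_cHat hω.2) heq)
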